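/- Let $\mathrm m$ be a rooted bipartite plane map with at least one edge, that is, a connected planar map (loops and multiple edges allowed, up to orientation-preserving homeomorphism of the sphere) with a marked root corner, a marked face (the outer face, not necessarily incident to the root corner) and a fixed proper colouring of its vertices in black and white. Let $\Delta_\circ$ be the maximal degree of its white vertices and let $d\ge\Delta_\circ$. An orientation assigns a value $\mathcal O(h)\in\mathbb Z_{\ge 0}$ to every half-edge $h$. It is fractional if for some $k>0$ one has $\mathcal O(h_1)+\mathcal O(h_2)=k$ for every edge $\{h_1,h_2\}$. It is an $\alpha_d$-orientation if it is fractional and $\sum_{h\sim v}\mathcal O(h)=\alpha_d(v)$ for every vertex $v$, where $\alpha_d(v)=\deg(v)$ if $v$ is white and $\alpha_d(v)=d\deg(v)$ if $v$ is black. A directed edge $(h_1,h_2)$, with $h_1$ incident to its tail, is forward if $\mathcal O(h_1)>0$. The orientation is minimal if there is no simple directed cycle all of whose edges are forward and which has the outer face on its right. Let $\mathcal O$ be the minimal $\alpha_d$-orientation of $\mathrm m$. Orient the edges of the dual map $\mathrm m^\dagger$ canonically: the dual edge $e^\dagger$ crosses $e$ with the white endpoint of $e$ on its left and the black endpoint on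 its right. Then $\mathrm m^\dagger$ is strongly connected. Let $v_\star^\dagger$ be the vertex of $\mathrm m^\dagger$ corresponding to the outer face of $\mathrm m$, and for a vertex $v^\dagger$ of $\mathrm m^\dagger$ let $\ell(v^\dagger)$ be the length of a shortest directed path in $\mathrm m^\dagger$ from $v_\star^\dagger$ to $v^\dagger$. Then for every directed edge $e^\dagger=(v_1^\dagger,v_2^\dagger)$ of $\mathrm m^\dagger$, dual to the edge $e$ of $\mathrm m$, $$\ell(v_1^\dagger)-\ell(v_2^\dagger)=\mathcal O_\circ(e)-1,$$ where $\mathcal O_\circ(e)$ is the value of $\mathcal O$ on the half-edge of $e$ incident to the white endpoint of $e$. -/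

import Mathlib

/-- A connected map drawn on an oriented closed surface, given combinatorially. `H` is the set of
half-edges, `rot h` is the half-edge that follows `h` in counterclockwise order around the vertex to
which `h` is incident, and `opp h` is the other half of the edge of `h`. A half-edge `h` also stands
for the directed edge `(h, opp h)`, whose tail is the vertex of `h`, and for the corner that follows
`h` in counterclockwise order around that vertex. Loops and multiple edges are allowed. -/
structure CombinatorialMap (H : Type*) where
  rot : Equiv.Perm H
  opp : Equiv.Perm H
  opp_opp : ∀ h, opp (opp h) = h
  opp_ne : ∀ h, opp h ≠ h
  connected : ∀ h k : H, ∃ g ∈ Subgroup.closure ({rot, opp} : Set (Equiv.Perm H)), g h = k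

namespace CombinatorialMap

variable {H : Type*} (M : CombinatorialMap H)

/-- Vertices are the cycles of `rot`. -/
def Vertex : Type _ := Quotient (Equiv.Perm.SameCycle.setoid M.rot)

/-- Edges are the cycles `{h, opp h}` of `opp`. -/
def Edge : Type _ := Quotient (Equiv.Perm.SameCycle.setoid M.opp)

/-- The directed edge that follows the directed edge `h` along the contour of the face on the left
of `h`: at the head of `h` one takes the half-edge that comes next after `opp h` in clockwise
order. -/
def facePerm : Equiv.Perm H := M.rot⁻¹ * M.opp

/-- Faces are the cycles of `facePerm`. -/
def Face : Type _ := Quotient (Equiv.Perm.SameCycle.setoid M.facePerm)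

/-- The vertex to which a half-edge is incident; it is the tail of the directed edge `h`. -/
def vertex (h : H) : M.Vertex := Quotient.mk (Equiv.Perm.SameCycle.setoid M.rot) h

/-- The face on the left of the directed edge `h`. -/
def leftFace (h : H) : M.Face := Quotient.mk (Equiv.Perm.SameCycle.setoid M.facePerm) h

/-- The face on the right of the directed edge `h`. -/
def rightFace (h : H) : M.Face := M.leftFace (M.opp h)

/-- The number of half-edges (equivalently, of corners) at a vertex; a loop counts twice. -/
noncomputable def degree (v : M.Vertex) : ℕ := Nat.card {h : H // M.vertex h = v}

end CombinatorialMap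

/-- A planar map: the underlying surface is the sphere, by Euler's formula. -/
structure PlanarMap (H : Type*) extends CombinatorialMap H where
  euler : Nat.card toCombinatorialMap.Vertex + Nat.card toCombinatorialMap.Face =
    Nat.card toCombinatorialMap.Edge + 2

/-- A rooted bipartite plane map: a planar map with a root corner, a marked (outer) face, and one of
its proper 2-colourings of the vertices (the vertices that are not white are black). The outer face
need not be the face of the root corner. -/
structure RootedBipartitePlaneMap (H : Type*) extends PlanarMap H where
  root : H
  outer : toCombinatorialMap.Face
  white : toCombinatorialMap.Vertex → Prop
  proper : ∀ h : H, white (toCombinatorialMap.vertex h) ↔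
    ¬ white (toCombinatorialMap.vertex (toCombinatorialMap.opp h))

/-! Orientations -/

namespace CombinatorialMap

variable {H : Type*} (M : CombinatorialMap H)

/-- An orientation `O : H → ℕ` is fractional if it is `k`-fractional for some `k > 0`. -/
def IsFractional (O : H → ℕ) : Prop := ∃ k : ℕ, 0 < k ∧ ∀ h, O h + O (M.opp h) = k

open Classical in
/-- The outdegree of a vertex: the sum of `O` over its incident half-edges. -/
noncomputable def outdeg [Fintype H] (O : H → ℕ) (v : M.Vertex) : ℕ :=
  ∑ h : H, if M.vertex h = v then O h else 0

/-- `O` is an `a`-orientation, for a function `a` on the vertices. -/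
def IsAlphaOrientation [Fintype H] (a : M.Vertex → ℕ) (O : H → ℕ) : Prop :=
  M.IsFractional O ∧ ∀ v, M.outdeg O v = a v

/-- `c 0, …, c n` are the consecutive directed edges of a simple directed cycle: the head of each is
the tail of the next one (indices in `Fin (n + 1)` are cyclic), no vertex is visited twice, and no
edge is used in both directions. -/
def IsSimpleCycle {n : ℕ} (c : Fin (n + 1) → H) : Prop :=
  (∀ i, M.vertex (M.opp (c i)) = M.vertex (c (i + 1))) ∧
  Function.Injective (fun i => M.vertex (c i)) ∧
  ∀ i j, c j ≠ M.opp (c i)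

/-- Two faces are joined by a sequence of faces in which consecutive ones share an edge that is
not an edge of `c`; that is, they are in one component of the complement of `c`. -/
def SameSide {n : ℕ} (c : Fin (n + 1) → H) : M.Face → M.Face → Prop :=
  Relation.ReflTransGen fun f g =>
    ∃ h : H, (∀ i, h ≠ c i ∧ h ≠ M.opp (c i)) ∧ M.leftFace h = f ∧ M.rightFace h = g

/-- The face `f` lies on the right of the cycle `c`. -/
def LiesOnRight {n : ℕ} (c : Fin (n + 1) → H) (f : M.Face) : Prop :=
  ∃ i, M.SameSide c (M.rightFace (c i)) f

/-- A cycle is counterclockwise, for `O` and the marked face `f`, if it is a simple directed cycle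
whose directed edges are all forward and which has `f` on its right. -/
def IsCounterclockwiseCycle (O : H → ℕ) (f : M.Face) {n : ℕ} (c : Fin (n + 1) → H) : Prop :=
  M.IsSimpleCycle c ∧ (∀ i, 0 < O (c i)) ∧ M.LiesOnRight c f

/-- `O` is minimal, for the marked face `f`, if it has no counterclockwise cycle. -/
def IsMinimal (O : H → ℕ) (f : M.Face) : Prop :=
  ∀ (n : ℕ) (c : Fin (n + 1) → H), ¬ M.IsCounterclockwiseCycle O f c

end CombinatorialMap

/-! Directed distances -/

/-- `DirectedPath r u v n`: there is a directed path of length `n` from `u` to `v` in the directed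
graph whose directed edges are given by `r`. -/
inductive DirectedPath {V : Type*} (r : V → V → Prop) (u : V) : V → ℕ → Prop
  | nil : DirectedPath r u u 0
  | snoc {v w : V} {n : ℕ} : DirectedPath r u v n → r v w → DirectedPath r u w (n + 1)

/-- Strong connectivity: any two vertices are joined by a directed path. -/
def StronglyConnected {V : Type*} (r : V → V → Prop) : Prop :=
  ∀ u v, ∃ n, DirectedPath r u v n

/-- The length of a shortest directed path from `u` to `v`. -/
noncomputable def directedDist {V : Type*} (r : V → V → Prop) (u v : V) : ℕ :=
  sInf {n | DirectedPath r u v n}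

namespace RootedBipartitePlaneMap

variable {H : Type*} (M : RootedBipartitePlaneMap H)

/-- The maximal degree of a white vertex. -/
noncomputable def maxWhiteDegree : ℕ := ⨆ v : {v : M.Vertex // M.white v}, M.degree v

open Classical in
/-- `α_d(v)` is `deg v` for `v` white and `d * deg v` for `v` black. -/
noncomputable def alpha (d : ℕ) (v : M.Vertex) : ℕ :=
  if M.white v then M.degree v else d * M.degree v

/-- The half-edges that are incident to a white vertex. -/
abbrev WhiteHalfEdge : Type _ := {h : H // M.white (M.vertex h)}

/-- Every edge has exactly one white half-edge, so that `M.WhiteHalfEdge` is a copy of the set of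
edges of the map, and of the set of edges of the dual map. -/
theorem existsUnique_whiteHalfEdge (h : H) :
    ∃! k : H, (k = h ∨ k = M.opp h) ∧ M.white (M.vertex k) := by
  have hp := M.proper h
  by_cases hw : M.white (M.vertex h)
  · refine ⟨h, ⟨Or.inl rfl, hw⟩, ?_⟩
    rintro k ⟨rfl | rfl, hk⟩
    · rfl
    · exact absurd hk (hp.1 hw)
  · refine ⟨M.opp h, ⟨Or.inr rfl, ?_⟩, ?_⟩
    · by_contra hc
      exact hw (hp.2 hc)
    · rintro k ⟨rfl | rfl, hk⟩
      · exact absurd hk hw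
      · rfl

/-- The tail of the dual edge of the edge with white half-edge `h`. The vertices of the dual map are
the faces of the map. The dual edge crosses its edge with the white endpoint on its left, that is,
it goes from the right side to the left side of the edge directed from white to black. -/
def dualTail (h : M.WhiteHalfEdge) : M.Face := M.rightFace h.1

/-- The head of the dual edge of the edge with white half-edge `h`. -/
def dualHead (h : M.WhiteHalfEdge) : M.Face := M.leftFace h.1

/-- The directed edges of the canonically oriented dual map. -/
def DualArc (f g : M.Face) : Prop := ∃ h : M.WhiteHalfEdge, M.dualTail h = f ∧ M.dualHead h = g

/-- The directed geodesic labelling of the dual map pointed at the outer face. -/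
noncomputable def geodesicLabel (f : M.Face) : ℕ := directedDist M.DualArc M.outer f

end RootedBipartitePlaneMap

/-! Double counting makes `O` a `(d + 1)`-fractional orientation. So `1 - O` on white half-edges and
`d - O` on black ones is antisymmetric and sums to zero around each vertex. On the sphere such a
function is the variation of a potential `x` on the faces (`PlanarMap.exists_potential`, a dimension
count from Euler's formula), and `x` is normalised to vanish on the outer face.

Along a dual arc `x` grows by `1 - O ≤ 1`, so `x` is at most the directed distance. Equality holds
on faces reached by tight arcs, those with `O = 0`, and minimality makes every face such a face
(`exists_tight_path`). Otherwise the boundary of the set `S` of reached faces, directed with `S` on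
its right, consists of forward edges and contains a simple cycle with the outer face on its right.
-/

namespace CombinatorialMap

variable {H : Type*} (M : CombinatorialMap H)

instance [Finite H] : Finite M.Vertex := by unfold Vertex; infer_instance

instance [Finite H] : Finite M.Edge := by unfold Edge; infer_instance

instance [Finite H] : Finite M.Face := by unfold Face; infer_instance

theorem vertex_surjective : Function.Surjective M.vertex := Quotient.mk_surjective

theorem leftFace_surjective : Function.Surjective M.leftFace := Quotient.mk_surjective

theorem vertex_rot (h : H) : M.vertex (M.rot h) = M.vertex h :=
  (Quotient.sound (s := Equiv.Perm.SameCycle.setoid M.rot)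
    (Equiv.Perm.sameCycle_apply_right.2 (Equiv.Perm.SameCycle.refl _ h))).symm

theorem leftFace_facePerm (h : H) : M.leftFace (M.facePerm h) = M.leftFace h :=
  (Quotient.sound (s := Equiv.Perm.SameCycle.setoid M.facePerm)
    (Equiv.Perm.sameCycle_apply_right.2 (Equiv.Perm.SameCycle.refl _ h))).symm

/-- The corner between `h` and `rot h` belongs to both faces. This makes sums of face variations
telescope around a vertex. -/
theorem rightFace_rot (h : H) : M.rightFace (M.rot h) = M.leftFace h := by
  have := M.leftFace_facePerm (M.opp (M.rot h))
  simpa [facePerm, M.opp_opp, rightFace] using this.symm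

theorem rightFace_opp (h : H) : M.rightFace (M.opp h) = M.leftFace h := by
  rw [rightFace, M.opp_opp]

theorem leftFace_opp (h : H) : M.leftFace (M.opp h) = M.rightFace h := rfl

/-- A function on half-edges that is invariant under `rot` and `opp` is constant. -/
theorem apply_eq_of_invariant {α : Type*} (x : H → α) (hr : ∀ h, x (M.rot h) = x h)
    (ho : ∀ h, x (M.opp h) = x h) (h k : H) : x h = x k := by
  obtain ⟨g, hg, rfl⟩ := M.connected h k
  have key : ∀ h, x (g h) = x h := by
    induction hg using Subgroup.closure_induction with
    | mem g hg =>
      rcases hg with rfl | rfl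
      · exact hr
      · exact ho
    | one => intro h; rfl
    | mul a b _ _ ha hb => intro h; rw [Equiv.Perm.mul_apply, ha, hb]
    | inv a _ ha => intro h; rw [← ha (a⁻¹ h), ← Equiv.Perm.mul_apply, mul_inv_cancel, Equiv.Perm.one_apply]
  exact (key h).symm

theorem eq_of_vertex_invariant {α : Type*} (x : M.Vertex → α)
    (hx : ∀ h, x (M.vertex h) = x (M.vertex (M.opp h))) (u v : M.Vertex) : x u = x v := by
  obtain ⟨h, rfl⟩ := M.vertex_surjective u
  obtain ⟨k, rfl⟩ := M.vertex_surjective v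
  exact M.apply_eq_of_invariant (fun h => x (M.vertex h)) (fun h => by rw [M.vertex_rot])
    (fun h => (hx h).symm) h k

theorem eq_of_face_invariant {α : Type*} (x : M.Face → α)
    (hx : ∀ h, x (M.leftFace h) = x (M.rightFace h)) (f g : M.Face) : x f = x g := by
  obtain ⟨h, rfl⟩ := M.leftFace_surjective f
  obtain ⟨k, rfl⟩ := M.leftFace_surjective g
  exact M.apply_eq_of_invariant (fun h => x (M.leftFace h))
    (fun h => by rw [hx, M.rightFace_rot]) (fun h => (hx h).symm) h k

open Classical in
/-- The variations of a function on the faces sum to zero around every vertex. -/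
theorem sum_leftFace_sub_rightFace [Fintype H] {R : Type*} [AddCommGroup R] (x : M.Face → R)
    (v : M.Vertex) :
    ∑ h : H, (if M.vertex h = v then x (M.leftFace h) - x (M.rightFace h) else 0) = 0 := by
  have h1 : ∑ h : H, (if M.vertex h = v then x (M.rightFace h) else 0) =
      ∑ h : H, if M.vertex h = v then x (M.leftFace h) else 0 := by
    rw [← Equiv.sum_comp M.rot]
    simp only [M.vertex_rot, M.rightFace_rot]
  have h2 : ∀ h : H, (if M.vertex h = v then x (M.leftFace h) - x (M.rightFace h) else 0) =
      (if M.vertex h = v then x (M.leftFace h) else 0) -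
        (if M.vertex h = v then x (M.rightFace h) else 0) := by
    intro h; split_ifs <;> simp
  rw [Finset.sum_congr rfl fun h _ => h2 h, Finset.sum_sub_distrib, h1, sub_self]

/-! ### Edges, incidence matrices and their ranks -/

/-- The edge of a half-edge. -/
def edge (h : H) : M.Edge := Quotient.mk (Equiv.Perm.SameCycle.setoid M.opp) h

theorem edge_eq_iff {h k : H} : M.edge h = M.edge k ↔ h = k ∨ h = M.opp k := by
  have hop : ∀ n : ℕ, ∀ h, (M.opp ^ n) h = h ∨ (M.opp ^ n) h = M.opp h := by
    intro n
    induction n with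
    | zero => intro h; left; rfl
    | succ n ih =>
      intro h
      rw [pow_succ', Equiv.Perm.mul_apply]
      rcases ih h with e | e <;> rw [e]
      · right; rfl
      · left; exact M.opp_opp h
  constructor
  · intro e
    have hs : M.opp.SameCycle k h := (Quotient.exact e :).symm
    obtain ⟨i, rfl⟩ := hs
    rcases i with n | n
    · exact hop n k
    · rw [zpow_negSucc, ← inv_pow]
      have hinv : M.opp⁻¹ = M.opp := by
        ext h; rw [Equiv.Perm.inv_eq_iff_eq, M.opp_opp]
      rw [hinv]
      exact hop _ k
  · rintro (rfl | rfl)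
    · rfl
    · exact (Quotient.sound (s := Equiv.Perm.SameCycle.setoid M.opp)
        (Equiv.Perm.sameCycle_apply_right.2 (Equiv.Perm.SameCycle.refl _ k))).symm

/-- A chosen half of an edge. -/
noncomputable def half (e : M.Edge) : H := Quotient.out e

theorem edge_half (e : M.Edge) : M.edge (M.half e) = e := Quotient.out_eq e

theorem sum_half_add_opp [Fintype H] [Fintype M.Edge] {R : Type*} [AddCommMonoid R] (x : H → R) :
    ∑ e : M.Edge, (x (M.half e) + x (M.opp (M.half e))) = ∑ h : H, x h := by
  classical
  rw [← Finset.sum_fiberwise_of_maps_to (g := M.edge) (t := Finset.univ) (fun _ _ => Finset.mem_univ _)]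
  refine Finset.sum_congr rfl fun e _ => ?_
  have : Finset.univ.filter (fun h => M.edge h = e) = {M.half e, M.opp (M.half e)} := by
    ext h
    rw [Finset.mem_filter, Finset.mem_insert, Finset.mem_singleton]
    conv_lhs => rw [← M.edge_half e, M.edge_eq_iff]
    simp
  rw [this, Finset.sum_pair (M.opp_ne _).symm]

open Classical in
/-- The incidence matrix of the map: `1` at the origin and `-1` at the end of the chosen half of
each edge. -/
noncomputable def incidence : Matrix M.Vertex M.Edge ℚ := fun v e =>
  (if M.vertex (M.half e) = v then 1 else 0) - if M.vertex (M.opp (M.half e)) = v then 1 else 0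

open Classical in
/-- The coboundary matrix of the dual map. -/
noncomputable def faceCoboundary : Matrix M.Edge M.Face ℚ := fun e f =>
  (if M.leftFace (M.half e) = f then 1 else 0) - if M.rightFace (M.half e) = f then 1 else 0

open Matrix

theorem transpose_incidence_mulVec [Fintype M.Vertex] (x : M.Vertex → ℚ) (e : M.Edge) :
    (M.incidenceᵀ *ᵥ x) e = x (M.vertex (M.half e)) - x (M.vertex (M.opp (M.half e))) := by
  classical
  simp [Matrix.mulVec, dotProduct, incidence, sub_mul, Finset.sum_sub_distrib]

theorem faceCoboundary_mulVec [Fintype M.Face] (x : M.Face → ℚ) (e : M.Edge) :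
    (M.faceCoboundary *ᵥ x) e = x (M.leftFace (M.half e)) - x (M.rightFace (M.half e)) := by
  classical
  simp [Matrix.mulVec, dotProduct, faceCoboundary, sub_mul, Finset.sum_sub_distrib]

open Classical in
theorem incidence_mulVec [Fintype H] [Fintype M.Edge] (g : H → ℚ)
    (hg : ∀ h, g (M.opp h) = -g h) (v : M.Vertex) :
    (M.incidence *ᵥ fun e => g (M.half e)) v = ∑ h : H, if M.vertex h = v then g h else 0 := by
  rw [← M.sum_half_add_opp]
  simp only [Matrix.mulVec, dotProduct, incidence, hg]
  refine Finset.sum_congr rfl fun e _ => ?_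
  split_ifs <;> ring

theorem half_or_opp_half (h : H) : h = M.half (M.edge h) ∨ h = M.opp (M.half (M.edge h)) :=
  M.edge_eq_iff.1 (M.edge_half _).symm

/-- The kernel of a linear map on `ι → ℚ` that consists of the constants has dimension one. -/
theorem finrank_ker_eq_one {ι : Type*} [Nonempty ι] {W : Type*} [AddCommGroup W]
    [Module ℚ W] (L : (ι → ℚ) →ₗ[ℚ] W) (hL : ∀ x, L x = 0 ↔ ∀ i j, x i = x j) :
    Module.finrank ℚ (LinearMap.ker L) = 1 := by
  have : LinearMap.ker L = Submodule.span ℚ {fun _ => 1} := by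
    ext x
    rw [LinearMap.mem_ker, hL, Submodule.mem_span_singleton]
    constructor
    · intro hx
      obtain ⟨i⟩ := ‹Nonempty ι›
      exact ⟨x i, by ext j; simp [hx i j]⟩
    · rintro ⟨a, rfl⟩ i j
      rfl
  rw [this, finrank_span_singleton]
  intro h0
  obtain ⟨i⟩ := ‹Nonempty ι›
  exact one_ne_zero (congrFun h0 i)

/-- By connectedness, the kernel of the transpose consists of the constants; rank-nullity does the
rest. -/
theorem rank_incidence [Fintype H] [Nonempty H] [Fintype M.Vertex] [Fintype M.Edge] :
    M.incidence.rank + 1 = Fintype.card M.Vertex := by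
  classical
  have : Nonempty M.Vertex := ⟨M.vertex (Classical.arbitrary H)⟩
  rw [← Matrix.rank_transpose, Matrix.rank, ← Module.finrank_fintype_fun_eq_card ℚ,
    ← LinearMap.finrank_range_add_finrank_ker M.incidenceᵀ.mulVecLin, finrank_ker_eq_one]
  intro x
  constructor
  · intro hx
    refine M.eq_of_vertex_invariant x fun h => ?_
    have := congrFun hx (M.edge h)
    rw [Matrix.mulVecLin_apply, M.transpose_incidence_mulVec, Pi.zero_apply, sub_eq_zero] at this
    rcases M.half_or_opp_half h with e | e
    · rw [← e] at this; exact this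
    · rw [e, M.opp_opp]; exact this.symm
  · intro hx
    ext e
    rw [Matrix.mulVecLin_apply, M.transpose_incidence_mulVec, Pi.zero_apply, sub_eq_zero]
    exact hx _ _

theorem rank_faceCoboundary [Fintype H] [Nonempty H] [Fintype M.Face] [Fintype M.Edge] :
    M.faceCoboundary.rank + 1 = Fintype.card M.Face := by
  classical
  have : Nonempty M.Face := ⟨M.leftFace (Classical.arbitrary H)⟩
  rw [Matrix.rank, ← Module.finrank_fintype_fun_eq_card ℚ,
    ← LinearMap.finrank_range_add_finrank_ker M.faceCoboundary.mulVecLin, finrank_ker_eq_one]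
  intro x
  constructor
  · intro hx
    refine M.eq_of_face_invariant x fun h => ?_
    have := congrFun hx (M.edge h)
    rw [Matrix.mulVecLin_apply, M.faceCoboundary_mulVec, Pi.zero_apply, sub_eq_zero] at this
    rcases M.half_or_opp_half h with e | e
    · rw [← e] at this; exact this
    · rw [e, M.rightFace_opp, M.leftFace_opp]; exact this.symm
  · intro hx
    ext e
    rw [Matrix.mulVecLin_apply, M.faceCoboundary_mulVec, Pi.zero_apply, sub_eq_zero]
    exact hx _ _

/-! ### Boundaries of sets of faces and simple cycles -/

open Classical in
/-- If the boundary of a set of faces enters a vertex, with the set on the right, then it leaves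
this vertex, with the set on the right. -/
theorem exists_next_boundary [Fintype H] (S : Set M.Face) (h : H) (hr : M.rightFace h ∈ S)
    (hl : M.leftFace h ∉ S) :
    ∃ k, M.vertex (M.opp h) = M.vertex k ∧ M.rightFace k ∈ S ∧ M.leftFace k ∉ S := by
  by_contra! hc
  have hsum := M.sum_leftFace_sub_rightFace (fun f => if f ∈ S then (1 : ℤ) else 0)
    (M.vertex (M.opp h))
  -- Only a half-edge with `S` on its right and not on its left gives a negative term, while `opp h`
  -- gives `+1`; the total is zero.
  have hnn : ∀ k ∈ Finset.univ, (0 : ℤ) ≤ if M.vertex k = M.vertex (M.opp h) then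
      (if M.leftFace k ∈ S then (1 : ℤ) else 0) - (if M.rightFace k ∈ S then 1 else 0) else 0 := by
    intro k _
    split_ifs with h1 h2 h3 h3 <;> simp
    exact h2 (hc k h1.symm h3)
  have := (Finset.sum_eq_zero_iff_of_nonneg hnn).1 hsum (M.opp h) (Finset.mem_univ _)
  simp [M.leftFace_opp, M.rightFace_opp, hr, hl] at this

/-- A nonempty set of half-edges that can be continued at every vertex it enters, and that contains
no edge in both directions, contains a simple directed cycle. -/
theorem exists_isSimpleCycle [Finite H] (B : Set H) (hB : B.Nonempty)
    (hopp : ∀ h ∈ B, M.opp h ∉ B)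
    (hnext : ∀ h ∈ B, ∃ k ∈ B, M.vertex (M.opp h) = M.vertex k) :
    ∃ (n : ℕ) (c : Fin (n + 1) → H), M.IsSimpleCycle c ∧ ∀ i, c i ∈ B := by
  classical
  obtain ⟨h₀, h₀B⟩ := hB
  choose! next hnB hnv using hnext
  let w : ℕ → H := fun i => next^[i] h₀
  have hwB : ∀ i, w i ∈ B := by
    intro i
    induction i with
    | zero => exact h₀B
    | succ i ih => simp only [w, Function.iterate_succ_apply'] at ih ⊢; exact hnB _ ih
  have hwv : ∀ i, M.vertex (M.opp (w i)) = M.vertex (w (i + 1)) := by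
    intro i
    have := hnv _ (hwB i)
    simpa only [w, Function.iterate_succ_apply'] using this
  -- The shortest return to a vertex, over all starting times, has no inner repetition and so is a
  -- simple cycle.
  have hex : ∃ n, ∃ i, M.vertex (w i) = M.vertex (w (i + n + 1)) := by
    obtain ⟨i, j, hij, e⟩ := Finite.exists_ne_map_eq_of_infinite fun i => M.vertex (w i)
    rcases lt_or_gt_of_ne hij with h | h
    · exact ⟨j - i - 1, i, by rw [show i + (j - i - 1) + 1 = j by omega]; exact e⟩
    · exact ⟨i - j - 1, j, by rw [show j + (i - j - 1) + 1 = i by omega]; exact e.symm⟩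
  obtain ⟨i, hi⟩ := Nat.find_spec hex
  set n := Nat.find hex
  have hmin : ∀ a b : ℕ, a < b → b ≤ n → M.vertex (w (i + a)) ≠ M.vertex (w (i + b)) := by
    intro a b hab hb e
    refine Nat.find_min hex (m := b - a - 1) (by omega) ⟨i + a, ?_⟩
    rw [show i + a + (b - a - 1) + 1 = i + b by omega]
    exact e
  refine ⟨n, fun j => w (i + j), ⟨fun j => ?_, fun a b hab => ?_, fun a b e => ?_⟩,
    fun j => hwB _⟩
  · dsimp only
    rw [hwv]
    by_cases hj : j = Fin.last n
    · subst hj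
      simp only [Fin.last_add_one, Fin.val_zero, Fin.val_last, add_zero]
      exact hi.symm
    · rw [Fin.val_add_one_of_lt (Fin.lt_last_iff_ne_last.2 hj), ← add_assoc]
  · dsimp only at hab
    by_contra hne
    rcases lt_or_gt_of_ne hne with h | h
    · exact hmin a b h (by omega) hab
    · exact hmin b a h (by omega) hab.symm
  · refine hopp _ (hwB (i + a)) ?_
    dsimp only at e
    rw [← e]
    exact hwB _

end CombinatorialMap

/-! ### Exactness on the sphere -/

namespace PlanarMap

variable {H : Type*} (M : PlanarMap H)

open Classical in
/-- On the sphere, an antisymmetric function on the half-edges that sums to zero around every vertex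
is the variation of a function on the faces. -/
theorem exists_potential [Fintype H] [Nonempty H] (g : H → ℚ) (hg : ∀ h, g (M.opp h) = -g h)
    (hv : ∀ v, ∑ h : H, (if M.vertex h = v then g h else 0) = 0) :
    ∃ x : M.Face → ℚ, ∀ h, g h = x (M.leftFace h) - x (M.rightFace h) := by
  have : Fintype M.Vertex := Fintype.ofFinite _
  have : Fintype M.Edge := Fintype.ofFinite _
  have : Fintype M.Face := Fintype.ofFinite _
  have hle : LinearMap.range M.faceCoboundary.mulVecLin ≤ LinearMap.ker M.incidence.mulVecLin := by
    rintro _ ⟨x, rfl⟩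
    ext v
    have := M.incidence_mulVec (fun h => x (M.leftFace h) - x (M.rightFace h))
      (fun h => by rw [M.leftFace_opp, M.rightFace_opp, neg_sub]) v
    rw [M.sum_leftFace_sub_rightFace] at this
    rw [Matrix.mulVecLin_apply, Matrix.mulVecLin_apply, Pi.zero_apply, ← this]
    congr 2
    ext e
    exact M.faceCoboundary_mulVec x e
  -- The range has dimension `F - 1` and the kernel `E - (V - 1)`; Euler's formula equates them.
  have heq := Submodule.eq_of_le_of_finrank_eq hle (by
    have h1 := M.rank_incidence
    have h2 := M.rank_faceCoboundary
    have h3 := LinearMap.finrank_range_add_finrank_ker M.incidence.mulVecLin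
    have h4 := M.euler
    simp only [Nat.card_eq_fintype_card] at h4
    rw [Module.finrank_fintype_fun_eq_card] at h3
    rw [Matrix.rank] at h1 h2
    omega)
  have hmem : (fun e => g (M.half e)) ∈ LinearMap.ker M.incidence.mulVecLin := by
    rw [LinearMap.mem_ker]
    ext v
    rw [Matrix.mulVecLin_apply, M.incidence_mulVec g hg, hv, Pi.zero_apply]
  rw [← heq] at hmem
  obtain ⟨x, hx⟩ := hmem
  have hx' : ∀ e, g (M.half e) = x (M.leftFace (M.half e)) - x (M.rightFace (M.half e)) :=
    fun e => by rw [← M.faceCoboundary_mulVec, ← Matrix.mulVecLin_apply, hx]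
  refine ⟨x, fun h => ?_⟩
  rcases M.half_or_opp_half h with e | e
  · have := hx' (M.edge h)
    rwa [← e] at this
  · rw [e, hg, hx', M.leftFace_opp, M.rightFace_opp, neg_sub]

end PlanarMap

/-! ### Strong connectivity of the dual map -/

theorem DirectedPath.mono {V : Type*} {r s : V → V → Prop} (hrs : ∀ u v, r u v → s u v) {u v : V}
    {n : ℕ} (h : DirectedPath r u v n) : DirectedPath s u v n := by
  induction h with
  | nil => exact .nil
  | snoc _ hr ih => exact ih.snoc (hrs _ _ hr)

namespace RootedBipartitePlaneMap

variable {H : Type*} (M : RootedBipartitePlaneMap H)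

theorem not_white_opp {h : H} (hw : M.white (M.vertex h)) : ¬ M.white (M.vertex (M.opp h)) :=
  (M.proper h).1 hw

theorem white_opp {h : H} (hw : ¬ M.white (M.vertex h)) : M.white (M.vertex (M.opp h)) := by
  by_contra hc
  exact hw ((M.proper h).2 hc)

/-- A set of faces that is closed under the arcs of the dual map is empty or contains all faces. -/
theorem eq_univ_of_dualArc_closed [Fintype H] (T : Set M.Face) (hT : T.Nonempty)
    (hcl : ∀ f g, f ∈ T → M.DualArc f g → g ∈ T) : T = Set.univ := by
  classical
  have key : ∀ h : H, M.white (M.vertex h) → (M.leftFace h ∈ T ↔ M.rightFace h ∈ T) := by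
    intro h hw
    refine ⟨fun hl => ?_, fun hr => hcl _ _ hr ⟨⟨h, hw⟩, rfl, rfl⟩⟩
    by_contra hr
    -- The boundary of `T` enters a white vertex along `opp h`, so it leaves along a white half-edge
    -- `k`, whose dual arc exits `T`.
    obtain ⟨k, hk, hkr, hkl⟩ := M.exists_next_boundary T (M.opp h)
      (by rwa [M.rightFace_opp]) (by rwa [M.leftFace_opp])
    rw [M.opp_opp] at hk
    exact hkl (hcl _ _ hkr ⟨⟨k, hk ▸ hw⟩, rfl, rfl⟩)
  have key' : ∀ h : H, (M.leftFace h ∈ T) = (M.rightFace h ∈ T) := by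
    intro h
    by_cases hw : M.white (M.vertex h)
    · exact propext (key h hw)
    · have := key _ (M.white_opp hw)
      rw [M.leftFace_opp, M.rightFace_opp] at this
      exact propext this.symm
  obtain ⟨f, hf⟩ := hT
  ext g
  have := M.eq_of_face_invariant (fun f => f ∈ T) key' f g
  simpa only [Set.mem_univ, iff_true, ← this]

theorem stronglyConnected_dualArc [Fintype H] : StronglyConnected M.DualArc := by
  intro u v
  have := M.eq_univ_of_dualArc_closed {f | ∃ n, DirectedPath M.DualArc u f n} ⟨u, 0, .nil⟩
    (by rintro f g ⟨n, hn⟩ hfg; exact ⟨n + 1, hn.snoc hfg⟩)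
  exact this.ge (Set.mem_univ v)

/-! ### Degrees and the potential of an orientation -/

open Classical in
theorem degree_eq_sum [Fintype H] (v : M.Vertex) :
    M.degree v = ∑ h : H, if M.vertex h = v then 1 else 0 := by
  rw [CombinatorialMap.degree, Nat.card_eq_fintype_card, Fintype.card_subtype, Finset.card_filter]

theorem degree_le_maxWhiteDegree [Finite H] {v : M.Vertex} (hv : M.white v) :
    M.degree v ≤ M.maxWhiteDegree :=
  le_ciSup (f := fun v : {v : M.Vertex // M.white v} => M.degree v)
    (Set.finite_range _).bddAbove ⟨v, hv⟩

theorem sum_ite_outdeg [Fintype H] [Fintype M.Vertex] (O : H → ℕ) (p : M.Vertex → Prop)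
    [DecidablePred p] :
    ∑ v : M.Vertex, (if p v then M.outdeg O v else 0) =
      ∑ h : H, if p (M.vertex h) then O h else 0 := by
  classical
  simp only [CombinatorialMap.outdeg]
  rw [← Finset.sum_fiberwise_of_maps_to (g := M.vertex) (t := Finset.univ)
    (fun _ _ => Finset.mem_univ _)]
  refine Finset.sum_congr rfl fun v _ => ?_
  rw [Finset.sum_filter]
  split_ifs with hp
  · refine Finset.sum_congr rfl fun h _ => ?_
    split_ifs with h1 h2
    · rfl
    · exact absurd (h1 ▸ hp) h2
    · rfl
  · symm
    refine Finset.sum_eq_zero fun h _ => ?_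
    split_ifs with h1 h2
    · exact absurd (h1 ▸ h2) hp
    · rfl
    · rfl

/-- An `α_d`-orientation is `(d + 1)`-fractional. -/
theorem add_opp_eq_of_isAlphaOrientation [Fintype H] {d : ℕ} {O : H → ℕ}
    (hO : M.IsAlphaOrientation (M.alpha d) O) (h : H) : O h + O (M.opp h) = d + 1 := by
  classical
  obtain ⟨⟨k, -, hk⟩, hv⟩ := hO
  have : Fintype M.Vertex := Fintype.ofFinite _
  let W : Finset H := Finset.univ.filter fun h => M.white (M.vertex h)
  let B : Finset H := Finset.univ.filter fun h => ¬ M.white (M.vertex h)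
  have hdeg : ∀ v, M.degree v = M.outdeg (fun _ => 1) v := fun v => M.degree_eq_sum v
  have hW : ∑ h ∈ W, O h = W.card := by
    rw [Finset.card_eq_sum_ones, Finset.sum_filter, Finset.sum_filter,
      ← M.sum_ite_outdeg O M.white, ← M.sum_ite_outdeg (fun _ => 1) M.white]
    refine Finset.sum_congr rfl fun v _ => ?_
    split_ifs with hw
    · rw [hv, alpha, if_pos hw, hdeg]
    · rfl
  have hB : ∑ h ∈ B, O h = d * B.card := by
    rw [Finset.card_eq_sum_ones, Finset.sum_filter, Finset.sum_filter,
      ← M.sum_ite_outdeg O fun v => ¬ M.white v,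
      ← M.sum_ite_outdeg (fun _ => 1) fun v => ¬ M.white v, Finset.mul_sum]
    refine Finset.sum_congr rfl fun v _ => ?_
    split_ifs with hw
    · rfl
    · rw [hv, alpha, if_neg hw, hdeg]
  have hBW : B = W.map M.opp.toEmbedding := by
    ext h
    simp only [B, W, Finset.mem_filter, Finset.mem_univ, true_and, Finset.mem_map,
      Equiv.coe_toEmbedding]
    constructor
    · exact fun hb => ⟨M.opp h, M.white_opp hb, M.opp_opp h⟩
    · rintro ⟨k, hk, rfl⟩
      exact M.not_white_opp hk
  have hcard : B.card = W.card := by rw [hBW, Finset.card_map]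
  have hsum : ∑ h ∈ B, O h = ∑ h ∈ W, O (M.opp h) := by rw [hBW, Finset.sum_map]; rfl
  -- With one white half-edge per edge, the total of `O` is `k` per edge, and also `1 + d` per edge
  -- by the vertex conditions.
  have htot : W.card * k = W.card * (d + 1) := by
    rw [← smul_eq_mul, ← Finset.sum_const, ← Finset.sum_congr rfl fun h _ => hk h,
      Finset.sum_add_distrib, hW, ← hsum, hB, hcard]
    ring
  have hpos : 0 < W.card := by
    refine Finset.card_pos.2 ?_
    by_cases hw : M.white (M.vertex h)
    · exact ⟨h, by simp [W, hw]⟩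
    · exact ⟨M.opp h, by simp [W, M.white_opp hw]⟩
  rw [hk]
  exact Nat.eq_of_mul_eq_mul_left hpos htot

/-- In an `α_d`-orientation with `d` at least the degree of every white vertex, every directed edge
from a black to a white vertex is forward. -/
theorem pos_of_not_white [Fintype H] {d : ℕ} (hd : M.maxWhiteDegree ≤ d) {O : H → ℕ}
    (hO : M.IsAlphaOrientation (M.alpha d) O) {h : H} (hb : ¬ M.white (M.vertex h)) : 0 < O h := by
  classical
  have hw := M.white_opp hb
  -- The white half carries at most its vertex's degree, hence at most `d` out of `d + 1`.
  have h1 : O (M.opp h) ≤ M.outdeg O (M.vertex (M.opp h)) := by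
    have := Finset.single_le_sum (f := fun k => if M.vertex k = M.vertex (M.opp h) then O k else 0)
      (fun _ _ => Nat.zero_le _) (Finset.mem_univ (M.opp h))
    simpa [CombinatorialMap.outdeg] using this
  rw [hO.2, alpha, if_pos hw] at h1
  have h2 := M.degree_le_maxWhiteDegree hw
  have h3 := M.add_opp_eq_of_isAlphaOrientation hO h
  omega

/-- The values of an `α_d`-orientation, minus one, are the variations of a function on the faces. -/
theorem exists_potential_of_isAlphaOrientation [Fintype H] {d : ℕ} {O : H → ℕ}
    (hO : M.IsAlphaOrientation (M.alpha d) O) :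
    ∃ x : M.Face → ℚ, x M.outer = 0 ∧
      ∀ e : M.WhiteHalfEdge, x (M.dualTail e) - x (M.dualHead e) = O e.1 - 1 := by
  classical
  have : Nonempty H := ⟨M.root⟩
  have hfrac := M.add_opp_eq_of_isAlphaOrientation hO
  have hdeg : ∀ v, (M.degree v : ℚ) = ∑ h : H, if M.vertex h = v then (1 : ℚ) else 0 := by
    intro v; rw [M.degree_eq_sum]; push_cast; rfl
  have hout : ∀ v, (M.outdeg O v : ℚ) = ∑ h : H, if M.vertex h = v then (O h : ℚ) else 0 := by
    intro v; rw [CombinatorialMap.outdeg]; push_cast; rfl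
  obtain ⟨x, hx⟩ := M.exists_potential
    (fun h => if M.white (M.vertex h) then 1 - (O h : ℚ) else d - (O h : ℚ))
    (by
      intro h
      have hf : (O h : ℚ) + O (M.opp h) = d + 1 := by exact_mod_cast hfrac h
      by_cases hw : M.white (M.vertex h)
      · simp only [hw, M.not_white_opp hw, if_true, if_false]; linarith
      · simp only [hw, M.white_opp hw, if_true, if_false]; linarith)
    (by
      intro v
      have hv : (M.outdeg O v : ℚ) = M.alpha d v := by rw [hO.2]
      by_cases hw : M.white v
      · rw [alpha, if_pos hw, hdeg, hout, eq_comm, ← sub_eq_zero, ← Finset.sum_sub_distrib] at hv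
        refine (Finset.sum_congr rfl fun h _ => ?_).trans hv
        split_ifs with h1 h2
        · rfl
        · exact absurd (h1 ▸ hw) h2
        · simp
      · rw [alpha, if_neg hw, Nat.cast_mul, hdeg, hout, eq_comm, ← sub_eq_zero, Finset.mul_sum,
          ← Finset.sum_sub_distrib] at hv
        refine (Finset.sum_congr rfl fun h _ => ?_).trans hv
        split_ifs with h1 h2
        · exact absurd (h1 ▸ h2) hw
        · ring
        · simp)
  refine ⟨fun f => x f - x M.outer, sub_self _, fun e => ?_⟩
  have := hx e.1
  simp only [e.2, if_true] at this
  simp only [dualTail, dualHead]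
  linarith

/-! ### Tight arcs and minimality -/

/-- The arcs of the dual map on which the orientation vanishes. -/
def TightArc (O : H → ℕ) (f g : M.Face) : Prop :=
  ∃ h : M.WhiteHalfEdge, (M.dualTail h = f ∧ M.dualHead h = g) ∧ O h.1 = 0

/-- In the minimal orientation, every face is reached from the outer face by dual arcs on which the
orientation vanishes. -/
theorem exists_tight_path [Fintype H] {d : ℕ} (hd : M.maxWhiteDegree ≤ d) {O : H → ℕ}
    (hO : M.IsAlphaOrientation (M.alpha d) O) (hmin : M.IsMinimal O M.outer) (f : M.Face) :
    ∃ n, DirectedPath (M.TightArc O) M.outer f n := by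
  let S : Set M.Face := {f | ∃ n, DirectedPath (M.TightArc O) M.outer f n}
  let B : Set H := {h | M.rightFace h ∈ S ∧ M.leftFace h ∉ S}
  -- From white to black, `O h = 0` would give a tight arc leaving `S`; from black to white, every
  -- edge is forward.
  have hfwd : ∀ h ∈ B, 0 < O h := by
    rintro h ⟨⟨n, hn⟩, hl⟩
    by_cases hw : M.white (M.vertex h)
    · rw [Nat.pos_iff_ne_zero]
      exact fun h0 => hl ⟨n + 1, hn.snoc ⟨⟨h, hw⟩, ⟨rfl, rfl⟩, h0⟩⟩
    · exact M.pos_of_not_white hd hO hw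
  by_contra hf
  have hB : B.Nonempty := by
    by_contra hB
    rw [Set.not_nonempty_iff_eq_empty, Set.eq_empty_iff_forall_notMem] at hB
    have hS : ∀ h, (M.leftFace h ∈ S) = (M.rightFace h ∈ S) := by
      intro h
      have h1 := hB h
      have h2 := hB (M.opp h)
      simp only [B, Set.mem_ofPred_eq, M.leftFace_opp, M.rightFace_opp] at h1 h2
      exact propext (by tauto)
    have := M.eq_of_face_invariant (fun f => f ∈ S) hS M.outer f
    exact hf (this.mp ⟨0, .nil⟩)
  obtain ⟨n, c, hc, hcB⟩ := M.exists_isSimpleCycle B hB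
    (fun h hh hh' => hh'.2 hh.1)
    (fun h hh => by
      obtain ⟨k, hk, hk'⟩ := M.exists_next_boundary S h hh.1 hh.2
      exact ⟨k, hk', hk⟩)
  -- A tight path from the outer face stays in `S`, whereas each edge of `c` has a face outside `S`,
  -- so the path, read backwards, never crosses `c`.
  have hside : ∀ g m, DirectedPath (M.TightArc O) M.outer g m → M.SameSide c g M.outer := by
    intro g m hp
    induction hp with
    | nil => exact .refl
    | @snoc u v m hp hr ih =>
      refine Relation.ReflTransGen.head ?_ ih
      have hv : v ∈ S := ⟨m + 1, hp.snoc hr⟩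
      have hu : u ∈ S := ⟨m, hp⟩
      obtain ⟨h, ⟨rfl, rfl⟩, -⟩ := hr
      refine ⟨h.1, fun i => ⟨fun e => ?_, fun e => ?_⟩, rfl, rfl⟩
      · exact (hcB i).2 (e ▸ hv)
      · have hu' : M.rightFace h.1 ∈ S := hu
        rw [e, M.rightFace_opp] at hu'
        exact (hcB i).2 hu'
  obtain ⟨m, hm⟩ := (hcB 0).1
  exact hmin n c ⟨hc, fun i => hfwd _ (hcB i), 0, hside _ m hm⟩

end RootedBipartitePlaneMap

/-! ### The potential equals the directed distance -/

theorem mainTheorem10 {H : Type*} [Fintype H] (M : RootedBipartitePlaneMap H) (d : ℕ)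
    (hd : M.maxWhiteDegree ≤ d) (O : H → ℕ)
    (hO : M.IsAlphaOrientation (M.alpha d) O) (hmin : M.IsMinimal O M.outer) :
    StronglyConnected M.DualArc ∧
      ∀ e : M.WhiteHalfEdge,
        (M.geodesicLabel (M.dualTail e) : ℤ) - (M.geodesicLabel (M.dualHead e) : ℤ) =
          (O e.1 : ℤ) - 1 := by
  refine ⟨M.stronglyConnected_dualArc, ?_⟩
  obtain ⟨x, hx0, hx⟩ := M.exists_potential_of_isAlphaOrientation hO
  have hle : ∀ f n, DirectedPath M.DualArc M.outer f n → x f ≤ n := by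
    intro f n hp
    induction hp with
    | nil => simp [hx0]
    | snoc _ hr ih =>
      obtain ⟨h, rfl, rfl⟩ := hr
      have h1 := hx h
      have h2 : (0 : ℚ) ≤ O h.1 := Nat.cast_nonneg _
      push_cast
      linarith
  have htight : ∀ f n, DirectedPath (M.TightArc O) M.outer f n → x f = n := by
    intro f n hp
    induction hp with
    | nil => simp [hx0]
    | snoc _ hr ih =>
      obtain ⟨h, ⟨rfl, rfl⟩, h0⟩ := hr
      have h1 := hx h
      rw [h0] at h1
      push_cast at h1 ⊢
      linarith
  have hlabel : ∀ f, (M.geodesicLabel f : ℚ) = x f := by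
    intro f
    obtain ⟨n, hn⟩ := M.exists_tight_path hd hO hmin f
    have hn' : DirectedPath M.DualArc M.outer f n := hn.mono fun _ _ ⟨h, hh, _⟩ => ⟨h, hh⟩
    have h1 : M.geodesicLabel f ≤ n := Nat.sInf_le hn'
    -- As a path exists, the infimum is an attained length and not the default `0`.
    have h2 := hle f _ (Nat.sInf_mem (s := {n | DirectedPath M.DualArc M.outer f n}) ⟨n, hn'⟩)
    refine le_antisymm ?_ h2
    rw [htight f n hn]
    exact_mod_cast h1
  intro e
  have := hx e
  rw [← hlabel, ← hlabel] at this
  exact_mod_cast this
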